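/- Let $J\in\{0,\tfrac12,1,\tfrac32,\dots\}$ and let $\alpha\in\mathbb R$ be any fixed angle. Quantum boxes. Let $\mathcal Q_{J,\alpha}$ be the set of all pairs $(E_1,E_2)\in\mathbb R^2$ for which there are a finite-dimensional complex Hilbert space $\mathcal H=\bigoplus_{j=-J}^{J}\mathcal H_j$ (orthogonal sum over $j=-J,-J+1,\dots,J$, where the dimensions $n_j=\dim\mathcal H_j\ge 0$ are arbitrary), carrying the unitary representation $U_\beta=\bigoplus_{j=-J}^{J}e^{ij\beta}\mathbf 1_{\mathcal H_j}$ $(\beta\in\mathbb R)$, a unit vector $\phi_1\in\mathcal H$, and a POVM $\{M_{1},M_{-1}\}$ on $\mathcal H$ (that is, $M_{\pm1}\ge 0$ and $M_1+M_{-1}=\mathbf 1$) such that, with $\phi_2=U_\alpha\phi_1$ and $M=M_1-M_{-1}$, $$E_x=\langle\phi_x|M|\phi_x\rangle\qquad(x=1,2).$$ Rotation boxes. Let $\mathcal R_{J,\alpha}$ be the set of all pairs $(E_1,E_2)$ with $$E_1=P(+1|0)-P(-1|0),\qquad E_2=P(+1|\alpha)-P(-1|\alpha),$$ where $P(b|\beta)$,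 $b\in\{\pm1\}$, $\beta\in\mathbb R$, are probabilities (that is, $P(b|\beta)\ge 0$ and $P(+1|\beta)+P(-1|\beta)=1$ for all $\beta$) of the form $$P(b|\beta)=\sum_{k=0}^{2J}\left(c_k^{(b)}\cos(k\beta)+s_k^{(b)}\sin(k\beta)\right)$$ with real coefficients $c_k^{(b)},s_k^{(b)}$. Then for every such $J$ and every $\alpha$, $\mathcal Q_{J,\alpha}=\mathcal R_{J,\alpha}$. -/

import Mathlib

namespace RotationBoxes

/-- A two-outcome measurement (POVM) on a complex Hilbert space, with outcomes `b ∈ {+1, -1}`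
(the type `ℤˣ`): positive operators `M b` which sum to the identity. -/
structure POVM (H : Type) [NormedAddCommGroup H] [InnerProductSpace ℂ H] where
  /-- the effect of each outcome -/
  effect : ℤˣ → H →L[ℂ] H
  isPositive : ∀ b, (effect b).IsPositive
  sum_eq_one : ∑ b, effect b = 1

/-- The observable `M = M₁ - M₋₁` whose expectation value is the bias `P(+1) - P(-1)`. -/
def POVM.observable {H : Type} [NormedAddCommGroup H] [InnerProductSpace ℂ H] (M : POVM H) :
    H →L[ℂ] H :=
  M.effect 1 - M.effect (-1)

/-- `U` is the representation `U_α = ⨁_{j = -J}^{J} n_j e^{ijα}` with `J = twoJ / 2`, where `j` runs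
over `-J, -J + 1, …, J` and the multiplicities `n_j ≥ 0` are arbitrary: there is an orthonormal
basis of `H`, consisting of `n_j` vectors for every `j = k - J`, `k = 0, …, 2J`, on which every
`U_α` acts by multiplication with `e^{ijα}`. In particular `H` is finite-dimensional. -/
def IsSpinRep {H : Type} [NormedAddCommGroup H] [InnerProductSpace ℂ H]
    (twoJ : ℕ) (U : ℝ → H →L[ℂ] H) : Prop :=
  ∃ (n : Fin (twoJ + 1) → ℕ) (e : OrthonormalBasis (Σ k, Fin (n k)) ℂ H),
    ∀ (α : ℝ) (k : Fin (twoJ + 1)) (i : Fin (n k)),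
      U α (e ⟨k, i⟩) =
        Complex.exp (Complex.I * (((k : ℕ) : ℂ) - (twoJ : ℂ) / 2) * (α : ℂ)) • e ⟨k, i⟩

/-- The quantum set `𝒬_{J,α}`, `J = twoJ / 2`: the pairs `(E₁, E₂)` with `E_x = ⟨φ_x|M|φ_x⟩`,
where `φ₁` is a normalized pure state, `φ₂ = U_α φ₁`, and `M = M₁ - M₋₁` for a POVM. -/
def quantumSet (twoJ : ℕ) (α : ℝ) : Set (ℝ × ℝ) :=
  {E | ∃ (H : Type) (_ : NormedAddCommGroup H) (_ : InnerProductSpace ℂ H)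
      (U : ℝ → H →L[ℂ] H) (M : POVM H) (φ₁ φ₂ : H),
      IsSpinRep twoJ U ∧ ‖φ₁‖ = 1 ∧ φ₂ = U α φ₁ ∧
      (E.1 : ℂ) = inner ℂ φ₁ (M.observable φ₁) ∧
      (E.2 : ℂ) = inner ℂ φ₂ (M.observable φ₂)}

/-- A rotation box of spin at most `J = twoJ / 2`: outcome probabilities `P(b|α)` for `b ∈ {+1, -1}`
and all angles `α`, each of which is a real trigonometric polynomial in `α` of degree at
most `2J`. -/
structure IsRotationBox (twoJ : ℕ) (P : ℤˣ → ℝ → ℝ) : Prop where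
  nonneg : ∀ b α, 0 ≤ P b α
  sum_eq_one : ∀ α, ∑ b, P b α = 1
  trigPoly : ∀ b, ∃ c s : ℕ → ℝ, ∀ α,
    P b α = ∑ k ∈ Finset.range (twoJ + 1), (c k * Real.cos (k * α) + s k * Real.sin (k * α))

/-- The rotation box set `ℛ_{J,α}`, `J = twoJ / 2`: the pairs `(E₁, E₂)` of the biases
`P(+1|·) - P(-1|·)` at the angles `0` and `α`. -/
def rotationBoxSet (twoJ : ℕ) (α : ℝ) : Set (ℝ × ℝ) :=
  {E | ∃ P : ℤˣ → ℝ → ℝ, IsRotationBox twoJ P ∧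
      E.1 = P 1 0 - P (-1) 0 ∧ E.2 = P 1 α - P (-1) α}

end RotationBoxes

/-! A quantum box gives a rotation box because expanding its outcome probabilities in eigenvectors
of `U` produces only the integer frequencies `l - k` with `|l - k| ≤ 2J`.

Conversely, the bias `f` of a rotation box is a trigonometric polynomial of degree at most `2J` with
`|f| ≤ 1`. With `α` reduced mod `2π` to `|s| ≤ π`, the Bernstein–Szegő bound
`IsTrigPoly.abs_arccos_sub_le` gives `δ = |arccos f(s) - arccos f(0)| ≤ 2J|s|`. This is exactly what
allows a state whose overlap with its rotated copy has modulus `cos (δ/2)` (`exists_weights`,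
`exists_model`). A measurement adapted to such a pair has the two prescribed expectations
(`exists_povm_of_norm_inner`). -/

namespace RotationBoxes

open Real Polynomial

/-! ### Trigonometric polynomials and their zeros -/

/-- Real trigonometric polynomials of degree at most `n`. -/
def IsTrigPoly (n : ℕ) (f : ℝ → ℝ) : Prop :=
  ∃ c s : ℕ → ℝ, ∀ x,
    f x = ∑ k ∈ Finset.range (n + 1), (c k * Real.cos (k * x) + s k * Real.sin (k * x))

namespace IsTrigPoly

variable {n : ℕ} {f g : ℝ → ℝ}

theorem zero : IsTrigPoly n fun _ => 0 := ⟨0, 0, by simp⟩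

theorem add (hf : IsTrigPoly n f) (hg : IsTrigPoly n g) : IsTrigPoly n fun x => f x + g x := by
  obtain ⟨c, s, h⟩ := hf
  obtain ⟨c', s', h'⟩ := hg
  refine ⟨c + c', s + s', fun x => ?_⟩
  beta_reduce
  rw [h, h', ← Finset.sum_add_distrib]
  refine Finset.sum_congr rfl fun k _ => ?_
  simp only [Pi.add_apply]
  ring

theorem const_mul (r : ℝ) (hf : IsTrigPoly n f) : IsTrigPoly n fun x => r * f x := by
  obtain ⟨c, s, h⟩ := hf
  refine ⟨fun k => r * c k, fun k => r * s k, fun x => ?_⟩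
  beta_reduce
  rw [h, Finset.mul_sum]
  refine Finset.sum_congr rfl fun k _ => ?_
  ring

theorem neg (hf : IsTrigPoly n f) : IsTrigPoly n fun x => -f x := by
  simpa using hf.const_mul (-1)

theorem sub (hf : IsTrigPoly n f) (hg : IsTrigPoly n g) : IsTrigPoly n fun x => f x - g x := by
  simpa [sub_eq_add_neg] using hf.add hg.neg

theorem sum {ι : Type*} (t : Finset ι) {F : ι → ℝ → ℝ} (h : ∀ i ∈ t, IsTrigPoly n (F i)) :
    IsTrigPoly n fun x => ∑ i ∈ t, F i x := by
  classical
  induction t using Finset.induction_on with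
  | empty => simpa using zero
  | insert i t hi ih =>
    simp only [Finset.sum_insert hi]
    exact (h i (Finset.mem_insert_self i t)).add
      (ih fun j hj => h j (Finset.mem_insert_of_mem hj))

theorem comp_neg (hf : IsTrigPoly n f) : IsTrigPoly n fun x => f (-x) := by
  obtain ⟨c, s, h⟩ := hf
  refine ⟨c, fun k => -s k, fun x => ?_⟩
  beta_reduce
  rw [h]
  refine Finset.sum_congr rfl fun k _ => ?_
  rw [mul_neg, Real.cos_neg, Real.sin_neg]
  ring

theorem single {m : ℕ} (hm : m ≤ n) (a b : ℝ) :
    IsTrigPoly n fun x => a * Real.cos (m * x) + b * Real.sin (m * x) := by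
  refine ⟨fun k => if k = m then a else 0, fun k => if k = m then b else 0, fun x => ?_⟩
  rw [Finset.sum_eq_single m]
  · simp
  · intro k _ hk
    simp [hk]
  · intro h
    simp at h
    omega

theorem re_mul_exp (w : ℂ) {m : ℤ} (hm : m.natAbs ≤ n) :
    IsTrigPoly n fun x => (w * Complex.exp (Complex.I * m * x)).re := by
  have key : ∀ x : ℝ, (w * Complex.exp (Complex.I * m * x)).re
      = w.re * Real.cos (m * x) - w.im * Real.sin (m * x) := by
    intro x
    have : Complex.I * m * x = ((m * x : ℝ) : ℂ) * Complex.I := by push_cast; ring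
    rw [this, Complex.mul_re, Complex.exp_ofReal_mul_I_re, Complex.exp_ofReal_mul_I_im]
  simp only [key]
  rcases Int.natAbs_eq m with h | h
  · convert single hm w.re (-w.im) using 2 with x
    rw [h]
    simp only [Int.cast_natCast, Int.natAbs_natCast]
    ring
  · convert single hm w.re w.im using 2 with x
    rw [h]
    simp only [Int.cast_neg, Int.cast_natCast, Int.natAbs_neg, Int.natAbs_natCast, neg_mul,
      Real.cos_neg, Real.sin_neg]
    ring

theorem continuous (hf : IsTrigPoly n f) : Continuous f := by
  obtain ⟨c, s, h⟩ := hf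
  rw [funext h]
  fun_prop

theorem add_int_mul_two_pi (hf : IsTrigPoly n f) (x : ℝ) (m : ℤ) :
    f (x + m * (2 * π)) = f x := by
  obtain ⟨c, s, h⟩ := hf
  rw [h, h]
  refine Finset.sum_congr rfl fun k _ => ?_
  have : (k : ℝ) * (x + m * (2 * π)) = k * x + ((k * m : ℤ) : ℝ) * (2 * π) := by
    push_cast; ring
  rw [this, Real.cos_add_int_mul_two_pi, Real.sin_add_int_mul_two_pi]

/-- With `z = e^{ix}`, `f` is a Laurent polynomial in `z`; the factor `z ^ n` clears the negative
powers, so zeros of `f` can be counted as roots. -/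
theorem exists_polynomial (hf : IsTrigPoly n f) :
    ∃ Q : ℂ[X], Q.natDegree ≤ 2 * n ∧
      ∀ x : ℝ, Q.eval (Complex.exp (x * Complex.I)) = Complex.exp (x * Complex.I) ^ n * f x := by
  obtain ⟨c, s, h⟩ := hf
  refine ⟨∑ k ∈ Finset.range (n + 1), (C ((c k - s k * Complex.I) / 2) * X ^ (n + k)
    + C ((c k + s k * Complex.I) / 2) * X ^ (n - k)), ?_, fun x => ?_⟩
  · refine natDegree_sum_le_of_forall_le _ _ fun k hk => ?_
    have hk : k < n + 1 := Finset.mem_range.mp hk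
    refine natDegree_add_le_of_degree_le ?_ ?_
    · exact (natDegree_C_mul_X_pow_le _ _).trans (by omega)
    · exact (natDegree_C_mul_X_pow_le _ _).trans (by omega)
  · rw [h, Polynomial.eval_finsetSum]
    push_cast
    rw [Finset.mul_sum]
    refine Finset.sum_congr rfl fun k hk => ?_
    have hk : k < n + 1 := Finset.mem_range.mp hk
    set z := Complex.exp (x * Complex.I) with hz
    have hz0 : z ≠ 0 := Complex.exp_ne_zero _
    have h1 : Complex.exp (k * x * Complex.I) = z ^ k := by
      rw [hz, ← Complex.exp_nat_mul]; ring_nf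
    have h2 : Complex.exp (-(k * x) * Complex.I) = (z ^ k)⁻¹ := by
      rw [← h1, ← Complex.exp_neg]; ring_nf
    have h3 : z ^ n = z ^ (n - k) * z ^ k := by
      rw [← pow_add]; congr 1; omega
    simp only [eval_add, eval_mul, eval_C, eval_pow, eval_X]
    rw [Complex.cos, Complex.sin, h1, h2, pow_add, h3]
    field_simp
    ring

/-- A trigonometric polynomial of degree at most `n` with more than `2n` zeros in a period
vanishes. -/
theorem eq_zero_of_zeros (hf : IsTrigPoly n f) (z : ℕ → ℝ)
    (hz : Set.InjOn z (Finset.range (2 * n + 1)))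
    (hmem : ∀ j < 2 * n + 1, z j ∈ Set.Ico 0 (2 * π)) (h0 : ∀ j < 2 * n + 1, f (z j) = 0)
    (x : ℝ) : f x = 0 := by
  obtain ⟨Q, hd, hQ⟩ := hf.exists_polynomial
  let e : ℝ → ℂ := fun x => Complex.exp (x * Complex.I)
  have hinj : Set.InjOn (fun j => e (z j)) (Finset.range (2 * n + 1)) := by
    intro i hi j hj hij
    refine hz hi hj ?_
    simp only [Finset.coe_range, Set.mem_Iio] at hi hj
    obtain ⟨m, hm⟩ := Complex.exp_eq_exp_iff_exists_int.mp hij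
    have hm' : z i = z j + m * (2 * π) := by
      have := congrArg Complex.im hm
      simpa using this
    have hpi := Real.pi_pos
    obtain ⟨h1, h2⟩ := hmem i hi
    obtain ⟨h3, h4⟩ := hmem j hj
    have hm1 : (m : ℝ) < 1 := by nlinarith
    have hm2 : (-1 : ℝ) < m := by nlinarith
    have : m = 0 := by
      have a : m < 1 := by exact_mod_cast hm1
      have b : -1 < m := by exact_mod_cast hm2
      omega
    simpa [this] using hm'
  have hQ0 : Q = 0 := by
    refine Polynomial.eq_zero_of_natDegree_lt_card_of_eval_eq_zero' Q
      ((Finset.range (2 * n + 1)).image fun j => e (z j)) ?_ ?_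
    · intro w hw
      obtain ⟨j, hj, rfl⟩ := Finset.mem_image.mp hw
      simp only [e]
      rw [hQ, h0 j (Finset.mem_range.mp hj)]
      simp
    · rw [Finset.card_image_of_injOn hinj, Finset.card_range]
      omega
  have := hQ x
  rw [hQ0, eval_zero, eq_comm, mul_eq_zero] at this
  rcases this with h | h
  · exact absurd h (pow_ne_zero _ (Complex.exp_ne_zero _))
  · exact_mod_cast h

end IsTrigPoly

/-! ### Bernstein–Szegő by comparison with a cosine -/

namespace IsTrigPoly

variable {n : ℕ} {f : ℝ → ℝ}

/-- If the bound failed, `G x = cos (n x + θ) - f x` would vanish at `0`, be positive at `a`, and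
alternate in sign at the extrema of the cosine. This forces `2n + 1` zeros in one period, hence `G =
0`, contradicting `G a > 0`. Strictness of `|f| < 1` keeps the signs strict. -/
theorem arccos_le_of_abs_lt_one (hf : IsTrigPoly n f) (hlt : ∀ x, |f x| < 1) {a : ℝ} (ha : 0 ≤ a)
    (hna : n * a < π) : arccos (f a) ≤ arccos (f 0) + n * a := by
  by_contra! h
  have hpi := Real.pi_pos
  have hn : n ≠ 0 := by
    rintro rfl
    obtain ⟨c, s, hcs⟩ := hf
    simp [hcs] at h
  have ha : 0 < a := by
    rcases ha.eq_or_lt with rfl | ha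
    · simp at h
    · exact ha
  have hn0 : (0 : ℝ) < n := by positivity
  set θ := arccos (f 0) with hθ
  have hθ0 : 0 < θ := arccos_pos.mpr (abs_lt.mp (hlt 0)).2
  set G : ℝ → ℝ := fun x => cos (n * x + θ) - f x with hG
  have hGt : IsTrigPoly n G := by
    refine IsTrigPoly.sub ?_ hf
    convert single le_rfl (cos θ) (-sin θ) using 2 with x
    rw [cos_add]
    ring
  have hGc : Continuous G := hGt.continuous
  have hG0 : G 0 = 0 := by
    simp only [hG, mul_zero, zero_add, hθ]
    rw [cos_arccos (abs_lt.mp (hlt 0)).1.le (abs_lt.mp (hlt 0)).2.le, sub_self]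
  have hGa : 0 < G a := by
    have h1 : cos (arccos (f a)) < cos (n * a + θ) :=
      cos_lt_cos_of_nonneg_of_le_pi (by positivity) (arccos_le_pi _) (by linarith)
    rw [cos_arccos (abs_lt.mp (hlt a)).1.le (abs_lt.mp (hlt a)).2.le] at h1
    simp only [hG]
    linarith
  -- The points where `cos (n x + θ) = (-1) ^ j`.
  set X : ℕ → ℝ := fun j => (j * π - θ) / n with hX
  have hXs : ∀ j, X j < X (j + 1) := by
    intro j
    simp only [hX]
    gcongr
    simp
  have hGX : ∀ j, 0 < (-1) ^ j * G (X j) := by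
    intro j
    have h1 : n * X j + θ = j * π := by
      simp only [hX]
      field_simp
      ring
    simp only [hG]
    rw [h1, cos_nat_mul_pi]
    obtain ⟨h2, h3⟩ := abs_lt.mp (hlt (X j))
    rcases neg_one_pow_eq_or ℝ j with h4 | h4 <;> rw [h4] <;> linarith
  have haX : a < X 1 := by
    simp only [hX]
    rw [lt_div_iff₀ hn0]
    have := arccos_le_pi (f a)
    push_cast
    linarith
  -- `X 0` is negative; `a` replaces it with the same sign of `G`, leaving room for the extra zero
  -- at `0`.
  set l : ℕ → ℝ := fun j => if j = 0 then a else X j with hl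
  have hlX : ∀ j, l j < X (j + 1) := by
    intro j
    by_cases hj : j = 0
    · simpa [hl, hj] using haX
    · simpa [hl, hj] using hXs j
  have hGl : ∀ j, 0 < (-1) ^ j * G (l j) := by
    intro j
    by_cases hj : j = 0
    · simpa [hl, hj] using hGa
    · simpa [hl, hj] using hGX j
  have hex : ∀ j, ∃ z, l j < z ∧ z < X (j + 1) ∧ G z = 0 := by
    intro j
    have hc : ContinuousOn (fun x => (-1) ^ j * G x) (Set.Icc (l j) (X (j + 1))) := by fun_prop
    have h2 : (-1) ^ j * G (X (j + 1)) < 0 := by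
      have := hGX (j + 1)
      rw [pow_succ] at this
      linarith
    obtain ⟨z, hz, hz0⟩ := intermediate_value_Ioo' (hlX j).le hc ⟨h2, hGl j⟩
    refine ⟨z, hz.1, hz.2, ?_⟩
    simpa using hz0
  choose z hz1 hz2 hz3 using hex
  let Z : ℕ → ℝ := fun j => Nat.casesOn j 0 z
  have hZ : StrictMono Z := by
    refine strictMono_nat_of_lt_succ fun j => ?_
    cases j with
    | zero => exact ha.trans (show a < z 0 by simpa [hl] using hz1 0)
    | succ j => exact (hz2 j).trans (show X (j + 1) < z (j + 1) by simpa [hl] using hz1 (j + 1))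
  -- The last zero used lies below `X (2n) = 2π - θ / n`.
  have hZ2 : Z (2 * n) < 2 * π := by
    obtain ⟨m, hm⟩ : ∃ m, 2 * n = m + 1 := ⟨2 * n - 1, by omega⟩
    rw [hm]
    refine (hz2 m).trans ?_
    rw [← hm]
    simp only [hX]
    rw [div_lt_iff₀ hn0]
    push_cast
    linarith
  refine hGa.ne' (hGt.eq_zero_of_zeros Z hZ.injective.injOn ?_ ?_ a)
  · intro j hj
    exact ⟨hZ.monotone (Nat.zero_le j), (hZ.monotone (by omega)).trans_lt hZ2⟩
  · intro j _
    cases j with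
    | zero => exact hG0
    | succ j => exact hz3 j

/-- The strict case applies to `r * f` with `r < 1`; then `r → 1`. For `n * a ≥ π` the bound is
trivial. -/
theorem arccos_le (hf : IsTrigPoly n f) (hle : ∀ x, |f x| ≤ 1) {a : ℝ} (ha : 0 ≤ a) :
    arccos (f a) ≤ arccos (f 0) + n * a := by
  rcases le_or_gt π (n * a) with h | h
  · linarith [arccos_le_pi (f a), arccos_nonneg (f 0)]
  have key : ∀ r ∈ Set.Ioo (0 : ℝ) 1, arccos (r * f a) ≤ arccos (r * f 0) + n * a := by
    intro r hr
    refine (hf.const_mul r).arccos_le_of_abs_lt_one (fun x => ?_) ha h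
    rw [abs_mul, abs_of_pos hr.1]
    nlinarith [hle x, hr.1, hr.2]
  have hc : ∀ y : ℝ, Filter.Tendsto (fun r => arccos (r * y)) (nhdsWithin 1 (Set.Iio 1))
      (nhds (arccos y)) := by
    intro y
    have : Continuous fun r => arccos (r * y) := continuous_arccos.comp (by fun_prop)
    simpa using (this.tendsto 1).mono_left nhdsWithin_le_nhds
  refine le_of_tendsto_of_tendsto (hc _) ((hc _).add_const _) ?_
  filter_upwards [Ioo_mem_nhdsLT (zero_lt_one' ℝ)] with r hr using key r hr

/-- The integrated Bernstein–Szegő inequality. -/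
theorem abs_arccos_sub_le (hf : IsTrigPoly n f) (hle : ∀ x, |f x| ≤ 1) (x : ℝ) :
    |arccos (f x) - arccos (f 0)| ≤ n * |x| := by
  have nonneg : ∀ {g : ℝ → ℝ}, IsTrigPoly n g → (∀ x, |g x| ≤ 1) → ∀ a, 0 ≤ a →
      |arccos (g a) - arccos (g 0)| ≤ n * a := by
    intro g hg hgle a ha
    have h1 := hg.arccos_le hgle ha
    -- Since `arccos (-y) = π - arccos y`, passing to `-g` reverses the inequality.
    have h2 := hg.neg.arccos_le (fun x => by rw [abs_neg]; exact hgle x) ha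
    simp only [arccos_neg] at h2
    rw [abs_le]
    constructor <;> linarith
  rcases le_total 0 x with h | h
  · rw [abs_of_nonneg h]
    exact nonneg hf hle x h
  · rw [abs_of_nonpos h]
    simpa using nonneg hf.comp_neg (fun x => hle (-x)) (-x) (by linarith)

end IsTrigPoly

/-! ### Convex combinations of phases -/

/-- The convex hull of `1, e^{is}, …, e^{ins}`. -/
def phaseHull (n : ℕ) (s : ℝ) : Set ℂ :=
  Fintype.linearCombination ℝ (fun k : Fin (n + 1) => Complex.exp ((k : ℕ) * s * Complex.I)) ''
    stdSimplex ℝ (Fin (n + 1))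

theorem convex_phaseHull (n : ℕ) (s : ℝ) : Convex ℝ (phaseHull n s) :=
  (convex_stdSimplex ℝ _).linear_image _

theorem exp_mem_phaseHull {n k : ℕ} (s : ℝ) (hk : k ≤ n) :
    Complex.exp (k * s * Complex.I) ∈ phaseHull n s := by
  refine ⟨Pi.single ⟨k, by omega⟩ 1, single_mem_stdSimplex ℝ _, ?_⟩
  simp

/-- The midpoint of `1` and `e^{iks}` has modulus `cos (ks / 2)`. -/
theorem exists_mem_phaseHull_of_le_pi {n k : ℕ} {s δ : ℝ} (hk : k ≤ n) (hδ : 0 ≤ δ)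
    (h1 : δ ≤ k * s) (h2 : k * s ≤ π) : ∃ w ∈ phaseHull n s, ‖w‖ ≤ cos (δ / 2) := by
  have h0 := exp_mem_phaseHull s (Nat.zero_le n)
  have hk' := exp_mem_phaseHull s hk
  refine ⟨_, (convex_phaseHull n s) h0 hk' (a := 1 / 2) (b := 1 / 2) (by norm_num) (by norm_num)
    (by norm_num), ?_⟩
  have key : (1 / 2 : ℝ) • Complex.exp ((0 : ℕ) * s * Complex.I)
      + (1 / 2 : ℝ) • Complex.exp (k * s * Complex.I)
      = (cos (k * s / 2) : ℝ) * Complex.exp ((k * s / 2 : ℝ) * Complex.I) := by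
    have e1 : (1 : ℂ) = Complex.exp (k * s / 2 * Complex.I) *
        Complex.exp (-(k * s / 2) * Complex.I) := by
      rw [← Complex.exp_add]; ring_nf; simp
    have e2 : Complex.exp (k * s * Complex.I)
        = Complex.exp (k * s / 2 * Complex.I) * Complex.exp (k * s / 2 * Complex.I) := by
      rw [← Complex.exp_add]; ring_nf
    push_cast
    rw [Complex.cos, e2]
    simp only [Complex.real_smul, zero_mul, Complex.exp_zero]
    push_cast
    linear_combination (1 / 2 : ℂ) * e1
  rw [key, norm_mul, Complex.norm_exp_ofReal_mul_I, mul_one, Complex.norm_real, norm_eq_abs,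
    abs_of_nonneg (cos_nonneg_of_mem_Icc ⟨by linarith, by linarith⟩)]
  exact cos_le_cos_of_nonneg_of_le_pi (by linarith) (by linarith [pi_pos]) (by linarith)

/-- If `0 < a < π ≤ b ≤ a + π`, then `0` lies in the triangle with vertices `1`, `e^{ia}`, `e^{ib}`. -/
theorem zero_mem_of_exp_mem {S : Set ℂ} (hS : Convex ℝ S) {a b : ℝ} (ha : 0 < a) (haπ : a < π)
    (hb : π ≤ b) (hba : b - a ≤ π) (h1 : 1 ∈ S) (h2 : Complex.exp (a * Complex.I) ∈ S)
    (h3 : Complex.exp (b * Complex.I) ∈ S) : 0 ∈ S := by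
  -- The barycentric weights of `0` are proportional to the areas it spans with the opposite sides:
  -- `sin (b - a)`, `-sin b`, `sin a`.
  have hA : 0 ≤ sin (b - a) := sin_nonneg_of_nonneg_of_le_pi (by linarith) hba
  have hB : 0 ≤ -sin b := by
    have : sin (b - π) = -sin b := by simp [sin_sub]
    rw [← this]
    exact sin_nonneg_of_nonneg_of_le_pi (by linarith) (by linarith)
  have hC : 0 < sin a := sin_pos_of_pos_of_lt_pi ha haπ
  set T := sin (b - a) + -sin b + sin a with hT
  have hTpos : 0 < T := by positivity
  have := hS.sum_mem (t := Finset.univ) (w := ![sin (b - a) / T, -sin b / T, sin a / T])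
    (z := ![1, Complex.exp (a * Complex.I), Complex.exp (b * Complex.I)])
    (by intro i _; fin_cases i <;> simp <;> positivity)
    (by
      simp only [Fin.sum_univ_three, Matrix.cons_val]
      rw [← add_div, ← add_div, ← hT, div_self hTpos.ne'])
    (by intro i _; fin_cases i <;> simpa)
  convert this using 1
  simp only [Fin.sum_univ_three, Matrix.cons_val, Complex.real_smul]
  apply Complex.ext
  · simp only [Complex.add_re, Complex.re_ofReal_mul, Complex.exp_ofReal_mul_I_re, Complex.zero_re,
      Complex.one_re]
    field_simp
    rw [sin_sub]
    ring
  · simp only [Complex.add_im, Complex.im_ofReal_mul, Complex.exp_ofReal_mul_I_im, Complex.zero_im,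
      Complex.one_im]
    field_simp
    ring

/-- Once the phases reach `π`, take the first `k` with `ks ≥ π`: either `e^{iks} = -1`, or `0` lies
in the triangle on `1`, `e^{i(k-1)s}`, `e^{iks}`. -/
theorem exists_mem_phaseHull {n : ℕ} {s δ : ℝ} (hs : 0 ≤ s) (hsπ : s ≤ π) (hδ : 0 ≤ δ)
    (hδπ : δ ≤ π) (h : δ ≤ n * s) : ∃ w ∈ phaseHull n s, ‖w‖ ≤ cos (δ / 2) := by
  rcases le_or_gt (n * s) π with hn | hn
  · exact exists_mem_phaseHull_of_le_pi le_rfl hδ h hn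
  classical
  have hex : ∃ k : ℕ, π ≤ k * s := ⟨n, hn.le⟩
  obtain ⟨k, hk1, hk2⟩ : ∃ k : ℕ, π ≤ k * s ∧ ∀ m < k, (m : ℝ) * s < π :=
    ⟨Nat.find hex, Nat.find_spec hex, fun m hm => not_le.mp (Nat.find_min hex hm)⟩
  have hkn : k ≤ n := by
    by_contra! hc
    exact absurd (hk2 n hc) (not_lt.mpr hn.le)
  rcases hk1.eq_or_lt with hk | hk
  · exact exists_mem_phaseHull_of_le_pi hkn hδ (hδπ.trans hk1) hk.ge
  obtain ⟨m, rfl⟩ : ∃ m, k = m + 1 := by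
    refine ⟨k - 1, ?_⟩
    have : k ≠ 0 := by
      rintro rfl
      simp at hk
      linarith [pi_pos]
    omega
  push_cast at hk
  have hs0 : 0 < s := by
    rcases hs.eq_or_lt with rfl | h0
    · simp at hk
      linarith [pi_pos]
    · exact h0
  refine ⟨0, zero_mem_of_exp_mem (convex_phaseHull n s) (a := m * s) (b := (m + 1) * s) ?_
    (hk2 m (by omega)) hk.le (by linarith) ?_ ?_ ?_, ?_⟩
  · nlinarith
  · simpa using exp_mem_phaseHull s (Nat.zero_le n)
  · simpa using exp_mem_phaseHull s (k := m) (n := n) (by omega)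
  · simpa using exp_mem_phaseHull s hkn
  · rw [norm_zero]
    exact cos_nonneg_of_mem_Icc ⟨by linarith [pi_pos], by linarith⟩

/-- Convex weights for which the convex combination of `1, e^{is}, …, e^{ins}` has prescribed
modulus `cos (δ / 2)`. -/
theorem exists_weights {n : ℕ} {s δ : ℝ} (hs : |s| ≤ π) (hδ : 0 ≤ δ) (hδπ : δ ≤ π)
    (h : δ ≤ n * |s|) : ∃ p ∈ stdSimplex ℝ (Fin (n + 1)),
      ‖∑ k, (p k : ℂ) * Complex.exp ((k : ℕ) * s * Complex.I)‖ = cos (δ / 2) := by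
  have key : ∃ p ∈ stdSimplex ℝ (Fin (n + 1)),
      ‖∑ k, (p k : ℂ) * Complex.exp ((k : ℕ) * (|s| : ℝ) * Complex.I)‖ = cos (δ / 2) := by
    obtain ⟨w, ⟨p, hp, hpw⟩, hw⟩ := exists_mem_phaseHull (abs_nonneg s) hs hδ hδπ h
    let F : (Fin (n + 1) → ℝ) → ℝ := fun p =>
      ‖∑ k, (p k : ℂ) * Complex.exp ((k : ℕ) * (|s| : ℝ) * Complex.I)‖
    have hF : Continuous F := by fun_prop
    have h1 : F p ≤ cos (δ / 2) := by
      rw [← hpw] at hw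
      simpa [F, Fintype.linearCombination_apply, Complex.real_smul] using hw
    have h2 : cos (δ / 2) ≤ F (Pi.single 0 1) := by
      have : F (Pi.single 0 1) = 1 := by
        simp only [F]
        rw [Finset.sum_eq_single 0]
        · simp
        · intro k _ hk
          simp [hk]
        · simp
      rw [this]
      exact cos_le_one _
    -- The modulus is continuous on the connected simplex, at most the target at `p` and `1` at a
    -- vertex.
    obtain ⟨q, hq, hq'⟩ := (convex_stdSimplex ℝ (Fin (n + 1))).isPreconnected.intermediate_value hp
      (single_mem_stdSimplex ℝ 0) hF.continuousOn ⟨h1, h2⟩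
    exact ⟨q, hq, hq'⟩
  rcases abs_choice s with h | h
  · rwa [h] at key
  · obtain ⟨p, hp, hpe⟩ := key
    refine ⟨p, hp, ?_⟩
    rw [← hpe, ← Complex.norm_conj, map_sum]
    congr 1
    refine Finset.sum_congr rfl fun k _ => ?_
    rw [map_mul, Complex.conj_ofReal, ← Complex.exp_conj, h]
    simp

/-! ### Measurements with prescribed expectations -/

section POVM

variable {H : Type} [NormedAddCommGroup H] [InnerProductSpace ℂ H]

theorem sum_intUnits {A : Type*} [AddCommMonoid A] (F : ℤˣ → A) : ∑ b, F b = F 1 + F (-1) := by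
  rw [UnitsInt.univ, Finset.sum_pair (by decide)]

theorem exists_povm_of_effect (T : H →L[ℂ] H) (hT : T.IsPositive) (hT' : (1 - T).IsPositive) :
    ∃ M : POVM H, M.observable = (2 : ℂ) • T - 1 := by
  refine ⟨⟨fun b => if b = 1 then T else 1 - T, fun b => ?_, ?_⟩, ?_⟩
  · split_ifs
    exacts [hT, hT']
  · rw [sum_intUnits]
    simp
  · simp only [POVM.observable, ↓reduceIte, if_neg (show (-1 : ℤˣ) ≠ 1 by decide), two_smul]
    abel

theorem exists_scalar_povm {c : ℝ} (hc : |c| ≤ 1) :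
    ∃ M : POVM H, ∀ x : H, ‖x‖ = 1 → inner ℂ x (M.observable x) = (c : ℂ) := by
  obtain ⟨h1, h2⟩ := abs_le.mp hc
  have hpos : ∀ r : ℝ, 0 ≤ r → ((r : ℂ) • (1 : H →L[ℂ] H)).IsPositive := fun r hr =>
    ContinuousLinearMap.isPositive_one.smul_of_nonneg (by exact_mod_cast hr)
  obtain ⟨M, hM⟩ := exists_povm_of_effect (H := H) ((((1 + c) / 2 : ℝ) : ℂ) • 1)
    (hpos _ (by linarith)) (by
      convert hpos ((1 - c) / 2) (by linarith) using 1
      ext x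
      simp only [sub_apply, smul_apply,
        one_apply_eq_self]
      nth_rw 1 [← one_smul ℂ x]
      rw [← sub_smul]
      congr 1
      push_cast
      ring)
  refine ⟨M, fun x hx => ?_⟩
  rw [hM]
  simp only [sub_apply, smul_apply,
    one_apply_eq_self, inner_sub_right, inner_smul_right, inner_self_eq_norm_sq_to_K,
    hx]
  push_cast
  ring

theorem exists_projective_povm [CompleteSpace H] {v : H} (hv : ‖v‖ = 1) :
    ∃ M : POVM H, ∀ x : H, ‖x‖ = 1 →
      inner ℂ x (M.observable x) = ((2 * ‖inner ℂ v x‖ ^ 2 - 1 : ℝ) : ℂ) := by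
  obtain ⟨M, hM⟩ := exists_povm_of_effect (InnerProductSpace.rankOne ℂ v v)
    (InnerProductSpace.isPositive_rankOne_self v)
    (.of_isStarProjection (InnerProductSpace.isStarProjection_rankOne_self hv).one_sub)
  refine ⟨M, fun x hx => ?_⟩
  rw [hM]
  simp only [sub_apply, smul_apply,
    one_apply_eq_self, inner_sub_right, inner_smul_right, inner_self_eq_norm_sq_to_K,
    hx, InnerProductSpace.rankOne_apply]
  rw [← inner_conj_symm x v, Complex.mul_conj, Complex.normSq_eq_norm_sq]
  push_cast
  ring

/-- Unit vectors `φ, ψ` at angle `b - a` have a unit vector `v` in their span at angles `a` and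
`b` from `φ` and `ψ`, respectively. -/
theorem exists_unit_of_inner_eq_cos {φ ψ : H} (hφ : ‖φ‖ = 1) (hψ : ‖ψ‖ = 1) {a b : ℝ}
    (hab : sin (b - a) ≠ 0) (h : inner ℂ φ ψ = (cos (b - a) : ℂ)) :
    ∃ v : H, ‖v‖ = 1 ∧ inner ℂ v φ = (cos a : ℂ) ∧ inner ℂ v ψ = (cos b : ℂ) := by
  have h' : inner ℂ ψ φ = (cos (b - a) : ℂ) := by
    rw [← inner_conj_symm, h]
    exact Complex.conj_ofReal _
  have hφ' : inner ℂ φ φ = 1 := by simp [inner_self_eq_norm_sq_to_K, hφ]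
  have hψ' : inner ℂ ψ ψ = 1 := by simp [inner_self_eq_norm_sq_to_K, hψ]
  -- In a plane with `v` at angle `0`, `φ` at `a` and `ψ` at `b`, one has `sin b • φ - sin a • ψ =
  -- sin (b - a) • v`.
  set v : H := ((sin b / sin (b - a) : ℝ) : ℂ) • φ - ((sin a / sin (b - a) : ℝ) : ℂ) • ψ with hv
  have hvφ : inner ℂ v φ = (cos a : ℂ) := by
    rw [hv, inner_sub_left, inner_smul_left, inner_smul_left, hφ', h', Complex.conj_ofReal,
      Complex.conj_ofReal]
    norm_cast
    field_simp
    rw [sin_sub, cos_sub]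
    linear_combination (sin b) * (sin_sq_add_cos_sq a).symm
  have hvψ : inner ℂ v ψ = (cos b : ℂ) := by
    rw [hv, inner_sub_left, inner_smul_left, inner_smul_left, hψ', h, Complex.conj_ofReal,
      Complex.conj_ofReal]
    norm_cast
    field_simp
    rw [sin_sub, cos_sub]
    linear_combination (sin a) * (sin_sq_add_cos_sq b)
  refine ⟨v, ?_, hvφ, hvψ⟩
  have hvv : inner ℂ v v = 1 := by
    nth_rw 2 [hv]
    rw [inner_sub_right, inner_smul_right, inner_smul_right, hvφ, hvψ]
    norm_cast
    field_simp
    rw [sin_sub]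
    ring
  have : ‖v‖ ^ 2 = 1 := by
    rw [← inner_self_eq_norm_sq (𝕜 := ℂ), hvv, RCLike.one_re]
  exact (pow_eq_one_iff_of_nonneg (norm_nonneg _) two_ne_zero).mp this

/-- Projecting onto a unit vector at angles `a`, `b` gives `2 cos² - 1 = cos 2a`, `cos 2b`. If `a =
b`, a state-independent random outcome suffices. -/
theorem exists_povm_of_norm_inner [CompleteSpace H] {φ ψ : H} (hφ : ‖φ‖ = 1) (hψ : ‖ψ‖ = 1)
    {a b : ℝ} (hab : a = b ∨ sin (b - a) ≠ 0) (h : ‖inner ℂ φ ψ‖ = cos (b - a)) :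
    ∃ M : POVM H, inner ℂ φ (M.observable φ) = (cos (2 * a) : ℂ) ∧
      inner ℂ ψ (M.observable ψ) = (cos (2 * b) : ℂ) := by
  rcases hab with rfl | hab
  · obtain ⟨M, hM⟩ := exists_scalar_povm (H := H) (abs_cos_le_one (2 * a))
    refine ⟨M, ?_, ?_⟩
    · rw [hM φ hφ]
    · rw [hM ψ hψ]
  -- Rephasing `ψ` by `u` makes the overlap real and leaves expectations unchanged.
  obtain ⟨u, hu, hu'⟩ : ∃ u : ℂ, ‖u‖ = 1 ∧ u * inner ℂ φ ψ = ‖inner ℂ φ ψ‖ := by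
    rcases eq_or_ne (inner ℂ φ ψ) 0 with h0 | h0
    · exact ⟨1, by simp, by simp [h0]⟩
    · refine ⟨‖inner ℂ φ ψ‖ / inner ℂ φ ψ, ?_, by field_simp⟩
      rw [norm_div, Complex.norm_real, norm_norm, div_self (norm_ne_zero_iff.mpr h0)]
  obtain ⟨v, hv, hvφ, hvψ⟩ := exists_unit_of_inner_eq_cos hφ (ψ := u • ψ)
    (by rw [norm_smul, hu, hψ, one_mul]) hab (by rw [inner_smul_right, hu', h])
  obtain ⟨M, hM⟩ := exists_projective_povm hv
  have hvψ' : ‖inner ℂ v ψ‖ = |cos b| := by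
    rw [inner_smul_right] at hvψ
    have := congrArg norm hvψ
    rw [norm_mul, hu, one_mul] at this
    rw [this, Complex.norm_real, norm_eq_abs]
  have hvφ' : ‖inner ℂ v φ‖ = |cos a| := by
    rw [hvφ, Complex.norm_real, norm_eq_abs]
  refine ⟨M, ?_, ?_⟩
  · rw [hM φ hφ, hvφ', sq_abs, ← cos_two_mul]
  · rw [hM ψ hψ, hvψ', sq_abs, ← cos_two_mul]

end POVM

/-! ### The two inclusions -/

/-- The phase `e^{i(k - J)β}`. -/
noncomputable def spinPhase (twoJ k : ℕ) (β : ℝ) : ℂ :=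
  Complex.exp (Complex.I * ((k : ℂ) - (twoJ : ℂ) / 2) * (β : ℂ))

theorem norm_spinPhase (twoJ k : ℕ) (β : ℝ) : ‖spinPhase twoJ k β‖ = 1 := by
  have : Complex.I * ((k : ℂ) - (twoJ : ℂ) / 2) * (β : ℂ)
      = ((((k : ℝ) - twoJ / 2) * β : ℝ) : ℂ) * Complex.I := by
    push_cast; ring
  rw [spinPhase, this, Complex.norm_exp_ofReal_mul_I]

theorem conj_spinPhase_mul (twoJ k l : ℕ) (β : ℝ) :
    (starRingEnd ℂ) (spinPhase twoJ k β) * spinPhase twoJ l β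
      = Complex.exp (Complex.I * ((l - k : ℤ) : ℂ) * β) := by
  rw [spinPhase, spinPhase, ← Complex.exp_conj, ← Complex.exp_add]
  congr 1
  simp only [map_mul, map_sub, map_div₀, Complex.conj_I, Complex.conj_ofReal, map_natCast,
    map_ofNat]
  push_cast
  ring

theorem quantumSet_subset (twoJ : ℕ) (α : ℝ) : quantumSet twoJ α ⊆ rotationBoxSet twoJ α := by
  rintro ⟨E₁, E₂⟩ ⟨H, _, _, U, M, φ, _, ⟨n, e, hU⟩, hφ, rfl, h1, h2⟩
  have hU' : ∀ β, U β φ = ∑ i, (inner ℂ (e i) φ * spinPhase twoJ i.1 β) • e i := by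
    intro β
    conv_lhs => rw [← e.sum_repr' φ]
    rw [map_sum]
    refine Finset.sum_congr rfl fun i _ => ?_
    rw [map_smul, hU β i.1 i.2, smul_smul]
    rfl
  have hnorm : ∀ β, ‖U β φ‖ = 1 := by
    intro β
    have : ‖U β φ‖ ^ 2 = 1 := by
      have hφ2 : ∑ i, ‖inner ℂ (e i) φ‖ ^ 2 = 1 := by
        rw [e.sum_sq_norm_inner_right, hφ, one_pow]
      rw [← e.sum_sq_norm_inner_right, ← hφ2]
      refine Finset.sum_congr rfl fun i _ => ?_
      rw [hU', e.orthonormal.inner_right_fintype, norm_mul, norm_spinPhase, mul_one]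
    exact (pow_eq_one_iff_of_nonneg (norm_nonneg _) two_ne_zero).mp this
  have hU0 : U 0 φ = φ := by
    rw [hU']
    conv_rhs => rw [← e.sum_repr' φ]
    simp [spinPhase]
  refine ⟨fun b β => (inner ℂ (U β φ) (M.effect b (U β φ))).re, ⟨fun b β => ?_, fun β => ?_,
    fun b => ?_⟩, ?_, ?_⟩
  · exact (M.isPositive b).re_inner_nonneg_right _
  · rw [← Complex.re_sum, ← inner_sum, ← sum_apply, M.sum_eq_one,
      one_apply_eq_self, inner_self_eq_norm_sq_to_K, hnorm]
    simp
  · have key : ∀ β, (inner ℂ (U β φ) (M.effect b (U β φ))).re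
        = ∑ i, ∑ j, ((starRingEnd ℂ) (inner ℂ (e i) φ) * inner ℂ (e j) φ
          * inner ℂ (e i) (M.effect b (e j))
          * Complex.exp (Complex.I * ((((j.1 : ℕ) : ℤ) - ((i.1 : ℕ) : ℤ) : ℤ) : ℂ) * β)).re := by
      intro β
      rw [hU' β, map_sum, sum_inner, Complex.re_sum]
      refine Finset.sum_congr rfl fun i _ => ?_
      rw [inner_sum, Complex.re_sum]
      refine Finset.sum_congr rfl fun j _ => ?_
      rw [map_smul, inner_smul_left, inner_smul_right, map_mul, ← conj_spinPhase_mul twoJ]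
      congr 1
      ring
    have : IsTrigPoly twoJ fun β => (inner ℂ (U β φ) (M.effect b (U β φ))).re := by
      simp only [key]
      refine .sum _ fun i _ => .sum _ fun j _ => .re_mul_exp _ ?_
      omega
    exact this
  · have := congrArg Complex.re h1
    simpa [hU0, POVM.observable, inner_sub_right] using this
  · have := congrArg Complex.re h2
    simpa [POVM.observable, inner_sub_right] using this

/-- Multiplicity one and amplitudes `√(p k)` make the overlap of `φ` with `U β φ` the `p`-average of
the phases. -/
theorem exists_model {twoJ : ℕ} (p : Fin (twoJ + 1) → ℝ)
    (hp : p ∈ stdSimplex ℝ (Fin (twoJ + 1))) :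
    ∃ (H : Type) (_ : NormedAddCommGroup H) (_ : InnerProductSpace ℂ H) (_ : CompleteSpace H)
      (U : ℝ → H →L[ℂ] H) (φ : H), IsSpinRep twoJ U ∧ ‖φ‖ = 1 ∧ (∀ β, ‖U β φ‖ = 1) ∧
      ∀ β, inner ℂ φ (U β φ) = ∑ k, (p k : ℂ) * spinPhase twoJ k β := by
  let ι := Σ _ : Fin (twoJ + 1), Fin 1
  let e := EuclideanSpace.basisFun ι ℂ
  let U : ℝ → EuclideanSpace ℂ ι →L[ℂ] EuclideanSpace ℂ ι := fun β =>
    ∑ i, spinPhase twoJ i.1 β • InnerProductSpace.rankOne ℂ (e i) (e i)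
  let φ : EuclideanSpace ℂ ι := ∑ i, ((√(p i.1) : ℝ) : ℂ) • e i
  have hUφ : ∀ β, U β φ = ∑ i, (spinPhase twoJ i.1 β * (√(p i.1) : ℝ)) • e i := by
    intro β
    simp only [U, sum_apply, smul_apply,
      InnerProductSpace.rankOne_apply]
    refine Finset.sum_congr rfl fun i _ => ?_
    rw [e.orthonormal.inner_right_fintype, smul_smul]
  have hsum : ∀ F : Fin (twoJ + 1) → ℝ, ∑ i : ι, F i.1 = ∑ k, F k := by
    intro F
    rw [Fintype.sum_sigma]
    simp
  have hunit : ∀ x : EuclideanSpace ℂ ι, (∀ i, ‖inner ℂ (e i) x‖ = √(p i.1)) → ‖x‖ = 1 := by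
    intro x hx
    have : ‖x‖ ^ 2 = 1 := by
      rw [← e.sum_sq_norm_inner_right]
      simp only [hx]
      rw [hsum fun k => √(p k) ^ 2, ← hp.2]
      exact Finset.sum_congr rfl fun k _ => sq_sqrt (hp.1 k)
    exact (pow_eq_one_iff_of_nonneg (norm_nonneg _) two_ne_zero).mp this
  refine ⟨EuclideanSpace ℂ ι, inferInstance, inferInstance, inferInstance, U, φ,
    ⟨fun _ => 1, e, fun β k i => ?_⟩, hunit _ fun i => ?_, fun β => hunit _ fun i => ?_,
    fun β => ?_⟩
  · simp only [U, sum_apply, smul_apply,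
      InnerProductSpace.rankOne_apply]
    rw [Finset.sum_eq_single ⟨k, i⟩]
    · rw [e.inner_eq_one, one_smul]
      rfl
    · intro j _ hj
      rw [e.inner_eq_zero hj, zero_smul, smul_zero]
    · simp
  · rw [e.orthonormal.inner_right_fintype, Complex.norm_real, norm_of_nonneg (sqrt_nonneg _)]
  · rw [hUφ, e.orthonormal.inner_right_fintype, norm_mul, norm_spinPhase, one_mul,
      Complex.norm_real, norm_of_nonneg (sqrt_nonneg _)]
  · rw [hUφ, e.orthonormal.inner_sum, Fintype.sum_sigma]
    simp only [Finset.univ_unique, Finset.sum_singleton]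
    refine Finset.sum_congr rfl fun k _ => ?_
    rw [Complex.conj_ofReal, mul_left_comm, ← Complex.ofReal_mul, mul_self_sqrt (hp.1 k), mul_comm]

/-- The common phase `e^{-iJβ}` drops out of the modulus. So the overlap modulus is `2π`-periodic
even for half-integer `J`, where `U` may change sign. -/
theorem norm_sum_spinPhase {twoJ : ℕ} (p : Fin (twoJ + 1) → ℝ) (s : ℝ) (m : ℤ) :
    ‖∑ k, (p k : ℂ) * spinPhase twoJ k (s + m * (2 * π))‖
      = ‖∑ k, (p k : ℂ) * Complex.exp ((k : ℕ) * s * Complex.I)‖ := by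
  have : ∀ k : ℕ, spinPhase twoJ k (s + m * (2 * π))
      = spinPhase twoJ 0 (s + m * (2 * π)) * Complex.exp (k * s * Complex.I) := by
    intro k
    rw [spinPhase, spinPhase, ← Complex.exp_add, Complex.exp_eq_exp_iff_exists_int]
    refine ⟨k * m, ?_⟩
    push_cast
    ring
  rw [← one_mul ‖∑ k, (p k : ℂ) * Complex.exp ((k : ℕ) * s * Complex.I)‖,
    ← norm_spinPhase twoJ 0 (s + m * (2 * π)), ← norm_mul, Finset.mul_sum]
  congr 1
  refine Finset.sum_congr rfl fun k _ => ?_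
  rw [this, mul_left_comm]

theorem rotationBoxSet_subset (twoJ : ℕ) (α : ℝ) : rotationBoxSet twoJ α ⊆ quantumSet twoJ α := by
  rintro ⟨E₁, E₂⟩ ⟨P, hP, h1, h2⟩
  dsimp only at h1 h2
  set f : ℝ → ℝ := fun x => P 1 x - P (-1) x with hf
  have hft : IsTrigPoly twoJ f := IsTrigPoly.sub (hP.trigPoly 1) (hP.trigPoly (-1))
  have hle : ∀ x, |f x| ≤ 1 := by
    intro x
    have := hP.sum_eq_one x
    rw [sum_intUnits] at this
    have h3 := hP.nonneg 1 x
    have h4 := hP.nonneg (-1) x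
    rw [abs_le]
    constructor <;> simp only [hf] <;> linarith
  have hpi := pi_pos
  obtain ⟨s, m, rfl, hs⟩ : ∃ (s : ℝ) (m : ℤ), α = s + m * (2 * π) ∧ |s| ≤ π := by
    refine ⟨α - round (α / (2 * π)) * (2 * π), round (α / (2 * π)), by ring, ?_⟩
    have h3 := abs_sub_round (α / (2 * π))
    have h4 : α - round (α / (2 * π)) * (2 * π) = (α / (2 * π) - round (α / (2 * π))) * (2 * π) := by
      field_simp
    rw [h4, abs_mul, abs_of_pos (show 0 < 2 * π by positivity)]
    nlinarith
  have h2 : E₂ = f s := h2.trans (hft.add_int_mul_two_pi s m)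
  have h1 : E₁ = f 0 := h1
  have hθ := hft.abs_arccos_sub_le hle s
  have hcos : ∀ x, cos (arccos (f x)) = f x := fun x =>
    cos_arccos (abs_le.mp (hle x)).1 (abs_le.mp (hle x)).2
  set a := arccos (f 0) with ha
  set b := arccos (f s) with hb
  have hba : |b - a| ≤ π := by
    have h3 := arccos_nonneg (f 0)
    have h4 := arccos_nonneg (f s)
    have h5 := arccos_le_pi (f 0)
    have h6 := arccos_le_pi (f s)
    rw [abs_le]
    constructor <;> linarith
  obtain ⟨p, hp, hpe⟩ := exists_weights hs (abs_nonneg (b - a)) hba hθ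
  obtain ⟨H, i1, i2, i3, U, φ, hU, hφ, hUφ, hin⟩ := exists_model p hp
  -- Angles are halved because the measurement doubles them: `cos (2 * (a / 2)) = f 0`, and likewise
  -- for `b`.
  obtain ⟨M, hM1, hM2⟩ := exists_povm_of_norm_inner hφ (hUφ (s + m * (2 * π)))
    (a := a / 2) (b := b / 2) (by
      rcases eq_or_ne a b with h | h
      · exact Or.inl (by rw [h])
      · refine Or.inr fun h0 => h ?_
        obtain ⟨h3, h4⟩ := abs_le.mp hba
        have := (sin_eq_zero_iff_of_lt_of_lt (by linarith) (by linarith)).mp h0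
        linarith) (by
      rw [hin, norm_sum_spinPhase, hpe, ← cos_abs (b / 2 - a / 2), ← sub_div, abs_div,
        abs_of_pos (two_pos (α := ℝ))])
  refine ⟨H, i1, i2, U, M, φ, _, hU, hφ, rfl, ?_, ?_⟩
  · rw [hM1, h1, mul_div_cancel₀ a two_ne_zero, hcos]
  · rw [hM2, h2, mul_div_cancel₀ b two_ne_zero, hcos]

end RotationBoxes

theorem theorem1 (twoJ : ℕ) (α : ℝ) :
    RotationBoxes.quantumSet twoJ α = RotationBoxes.rotationBoxSet twoJ α :=
  (RotationBoxes.quantumSet_subset twoJ α).antisymm (RotationBoxes.rotationBoxSet_subset twoJ α)
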